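/- **Theorem (two-pass algorithm for simulating random walks).** Let $G=(V,E)$ be a directed graph on $V=\{0,\dots,n-1\}$ with $E\subseteq V\times V$ (self-loops allowed, no multi-edges). For $u\in V$ and an integer $L\ge 0$ let $\mathsf{RW}^G_L(u)$ denote the distribution on $V^{L+1}$ of the walk $(v_0,\dots,v_L)$ with $v_0=u$ in which each $v_{i}$, $1\le i\le L$, is a uniformly random out-neighbour of $v_{i-1}$ (if $v_{i-1}$ has no out-neighbour, the walk stays at $v_{i-1}$). A *$p$-pass streaming algorithm oblivious to the starting vertex* consists of two randomized phases. The preprocessing phase reads the edges of $G$ one by one, each exactly once per pass, in an arbitrary order (the same order in each pass), makes $p$ passes without knowing the starting vertex, and outputs a message $M$. The sampling phase has read-only access to $M$ and to the starting vertex $u_{\sf start}$, and writes vertices one by one to a write-only output tape. Such an algorithm uses *$S$ words of space* if the memory configurations of each of the two phases, and the messages, can be encoded by $S$ words, a word being $\lfloor\log_2 n\rfloor+1$ bits; the output tape and the local computation of a transition between configurations are not counted. There are a constant $C$ and a two-pass streaming algorithm oblivious to the starting vertex, which is given $n$, an integer $L\ge 0$ and an error parameter $\delta\in(0,1/n)$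 with $n\geq 1$, such that for all such $n,L,\delta$: 1. the algorithm uses at most $C\cdot n\cdot\sqrt L\cdot\log\delta^{-1}$ words of space (hence $\tilde O(n\cdot\sqrt L\cdot\log\delta^{-1})$ bits); 2. for every directed graph $G$ on $n$ vertices, every order of the edges in the stream and every starting vertex $u_{\sf start}\in V$, the first $L+1$ vertices that it outputs have a distribution $\mathcal D$ on $V^{L+1}$ with $\|\mathcal D-\mathsf{RW}^G_L(u_{\sf start})\|_{\rm TV}\le\delta$. -/

import Mathlib

/-! ### Random walks on directed graphs

Directed graphs on `V` are Mathlib's `Digraph V`: self-loops are allowed, multi-edges are not. -/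

/-- The finite set of out-neighbours of `u`. -/
noncomputable def Digraph.outNbrs {V : Type*} [Fintype V] (G : Digraph V) (u : V) : Finset V := by
  classical exact Finset.univ.filter (fun v => G.Adj u v)

/-- One step of the random walk: a uniformly random out-neighbour of `u`. A vertex without
out-neighbours is absorbing: the walk stays there. -/
noncomputable def Digraph.walkStep {V : Type*} [Fintype V] (G : Digraph V) (u : V) : PMF V := by
  classical exact
    if h : (G.outNbrs u).Nonempty then PMF.uniformOfFinset (G.outNbrs u) h else PMF.pure u

/-- The distribution of the `L`-step random walk `(v₀, …, v_L)` with `v₀ = u`. -/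
noncomputable def Digraph.randomWalk {V : Type*} [Fintype V] (G : Digraph V) :
    (L : ℕ) → V → PMF (Fin (L + 1) → V)
  | 0, u => PMF.pure (fun _ => u)
  | L + 1, u => (G.walkStep u).bind fun v =>
      (G.randomWalk L v).map fun walk => (Fin.cons u walk : Fin (L + 2) → V)

/-- `s` is a stream of the edges of `G`: it lists every edge exactly once, in any order. -/
def Digraph.IsEdgeStream {V : Type*} (G : Digraph V) (s : List (V × V)) : Prop :=
  s.Nodup ∧ ∀ u v : V, (u, v) ∈ s ↔ G.Adj u v

/-- Total variation distance of two distributions on a finite set. -/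
noncomputable def PMF.tvDist {α : Type*} [Fintype α] (p q : PMF α) : ℝ :=
  (1 / 2) * ∑ a, |(p a).toReal - (q a).toReal|

/-! ### Streaming algorithms -/

/-- A randomized `p`-pass streaming algorithm for simulating random walks on graphs with vertex set
`Fin n` that is oblivious to the starting vertex. As usual for streaming algorithms, it is given by
its memory configurations and its (randomized) transitions between them; space is charged for the
configurations, the local computation of a transition is free.

* The preprocessing phase reads the edges one by one, `p` times, without access to the starting
  vertex. It starts in the configuration `init`, moves according to `update` when it reads an edge
  and according to `endPass` when it reaches the end of the stream; its output is `message` of the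
  last configuration.
* The sampling phase has read-only access to the message and to the starting vertex. It starts in
  the configuration `start`, and each application of `next` writes one vertex to a write-only output
  tape and moves to a new configuration.

All randomness is fresh in each transition; what is to be remembered, including the number of
the current pass, has to be part of the configuration. -/
structure ObliviousStreamingAlgorithm (n p : ℕ) where
  /-- memory configurations of the preprocessing phase -/
  Mem : Type
  /-- messages from the preprocessing phase to the sampling phase -/
  Msg : Type
  /-- memory configurations of the sampling phase -/
  Work : Type
  init : Mem
  update : Mem → Fin n × Fin n → PMF Mem
  endPass : Mem → PMF Mem
  message : Mem → Msg
  start : Work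
  next : Msg → Fin n → Work → PMF (Fin n × Work)

/-- The objects of type `α` can be stored in `S` words, where a word consists of `Nat.size n` bits,
the number of binary digits of `n`. -/
def FitsInWords (n S : ℕ) (α : Type) : Prop :=
  Nonempty (α ↪ (Fin S → BitVec (Nat.size n)))

namespace ObliviousStreamingAlgorithm

variable {n p : ℕ} (A : ObliviousStreamingAlgorithm n p)

/-- Both phases use at most `S` words of memory, and the message has at most `S` words. -/
def UsesSpace (S : ℕ) : Prop :=
  FitsInWords n S A.Mem ∧ FitsInWords n S A.Msg ∧ FitsInWords n S A.Work

/-- Configuration after reading the stream `s` once, and its end, starting from `m`. -/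
noncomputable def runPass : List (Fin n × Fin n) → A.Mem → PMF A.Mem
  | [], m => A.endPass m
  | e :: s, m => (A.update m e).bind (runPass s)

/-- Configuration after `k` passes over the stream `s`, starting from `m`. -/
noncomputable def runPasses (s : List (Fin n × Fin n)) : ℕ → A.Mem → PMF A.Mem
  | 0, m => PMF.pure m
  | k + 1, m => (A.runPass s m).bind (runPasses s k)

/-- The distribution of the message after `p` passes over the stream `s`. -/
noncomputable def preprocess (s : List (Fin n × Fin n)) : PMF A.Msg :=
  (A.runPasses s p A.init).map A.message

/-- The next `L + 1` vertices that the sampling phase writes to the output tape, starting from the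
configuration `c`. -/
noncomputable def emit (M : A.Msg) (u : Fin n) : (L : ℕ) → A.Work → PMF (Fin (L + 1) → Fin n)
  | 0, c => (A.next M u c).map fun r _ => r.1
  | L + 1, c => (A.next M u c).bind fun r =>
      (emit M u L r.2).map fun walk => (Fin.cons r.1 walk : Fin (L + 2) → Fin n)

/-- The output distribution of the whole algorithm, on the edge stream `s`, for the starting
vertex `u` and `L` steps. -/
noncomputable def output (s : List (Fin n × Fin n)) (u : Fin n) (L : ℕ) :
    PMF (Fin (L + 1) → Fin n) :=
  (A.preprocess s).bind fun M => A.emit M u L A.start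

end ObliviousStreamingAlgorithm

/-! Let `r` be about `√L`. The first pass stores `K = O(log δ⁻¹)` independent families of `r`
sampled steps from every vertex. Using the `i`-th sample at time `i`, a family gives from each `b` a
trajectory distributed exactly as an `r`-step walk (`Digraph.expect_trajectory`). A pair `(a, b)` is
light if no trajectory from `b` visits `a`, and heavy otherwise. Heavy edges into `b` are indexed by
the `K (r + 1)` positions on its trajectories, so the second pass can record all of them. For the
light edges out of each vertex it keeps their number and, by reservoir sampling, `T = O(r + log
δ⁻¹)` independent uniform samples. The sampling phase chooses a recorded heavy edge or the class of
light edges with the correct weights, and spends one unused sample per light exit. This reproduces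
the random walk until some vertex needs more than `T` samples.

Shortage is rare. If the walk from `b` avoids `a` for `r` steps with probability below `1/4`, then
`(a, b)` is light with probability at most `4⁻ᴷ`; a union bound over pairs excludes this
(`Digraph.expect_exists_isLight_le`). Otherwise each light exit from `u` is followed, with
probability at least `1/4`, by `r` steps away from `u`. A walk of at most `r²` steps can afford only
`r` such excursions, and the moment `E[(8/7) ^ exits]` is at most `2 ^ r`
(`expect_pow_exitCount_le`). Markov's inequality and a union bound over `u` finish the estimate.

For the comparison, fix the first-pass table; the second-pass samples are fresh. Revealing each
sample only when it is used shows that the output dominates the random walk on all walks within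
budget (`TwoPassWalk.expect_walkTail_le_expect_emission`). Domination in one direction suffices,
because both distributions have mass 1 (`PMF.tvDist_le_of_expect_le`). -/

open scoped ENNReal

/-! ### Expectations -/

namespace PMF

/-- The expectation of an extended nonnegative function. -/
noncomputable def expect {α : Type*} (p : PMF α) (f : α → ℝ≥0∞) : ℝ≥0∞ := ∑' a, p a * f a

section expect

variable {α β : Type*} (p : PMF α)

@[simp] theorem expect_pure (a : α) (f : α → ℝ≥0∞) : (pure a).expect f = f a := by
  rw [expect, tsum_eq_single a]
  · simp
  · intro b hb; simp [hb]

@[simp] theorem expect_bind (g : α → PMF β) (f : β → ℝ≥0∞) :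
    (p.bind g).expect f = p.expect fun a => (g a).expect f := by
  simp only [expect, bind_apply, ← ENNReal.tsum_mul_right, ← ENNReal.tsum_mul_left]
  rw [ENNReal.tsum_comm]
  simp only [mul_assoc]

@[simp] theorem expect_map (g : α → β) (f : β → ℝ≥0∞) :
    (p.map g).expect f = p.expect fun a => f (g a) := by
  simp [map]

theorem expect_mono {f g : α → ℝ≥0∞} (h : ∀ a, f a ≤ g a) : p.expect f ≤ p.expect g :=
  ENNReal.tsum_le_tsum fun a => mul_le_mul_right (h a) _

@[simp] theorem expect_const (c : ℝ≥0∞) : p.expect (fun _ => c) = c := by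
  simp [expect, ENNReal.tsum_mul_right, p.tsum_coe]

theorem expect_add (f g : α → ℝ≥0∞) :
    p.expect (fun a => f a + g a) = p.expect f + p.expect g := by
  simp [expect, mul_add, ENNReal.tsum_add]

theorem expect_mul_const (f : α → ℝ≥0∞) (c : ℝ≥0∞) :
    p.expect (fun a => f a * c) = p.expect f * c := by
  simp [expect, ← mul_assoc, ENNReal.tsum_mul_right]

theorem expect_const_mul (f : α → ℝ≥0∞) (c : ℝ≥0∞) :
    p.expect (fun a => c * f a) = c * p.expect f := by
  simp [mul_comm c, expect_mul_const]

theorem expect_finset_sum {ι : Type*} (s : Finset ι) (f : ι → α → ℝ≥0∞) :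
    p.expect (fun a => ∑ i ∈ s, f i a) = ∑ i ∈ s, p.expect (f i) := by
  classical
  induction s using Finset.induction_on with
  | empty => simp
  | insert i s hi ih => simp [Finset.sum_insert hi, expect_add, ih]

theorem expect_eq_sum [Fintype α] (f : α → ℝ≥0∞) : p.expect f = ∑ a, p a * f a :=
  tsum_fintype _

theorem expect_comm (q : PMF β) (f : α → β → ℝ≥0∞) :
    (p.expect fun a => q.expect (f a)) = q.expect fun b => p.expect fun a => f a b := by
  simp only [expect, ← ENNReal.tsum_mul_left]
  rw [ENNReal.tsum_comm]
  simp only [mul_left_comm]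

theorem apply_eq_expect [DecidableEq α] (a : α) :
    p a = p.expect fun b => if b = a then 1 else 0 := by
  rw [expect, tsum_eq_single a]
  · simp
  · intro b hb; simp [hb]

theorem ext_expect {p q : PMF α} (h : ∀ f, p.expect f = q.expect f) : p = q := by
  classical
  ext a
  rw [apply_eq_expect, apply_eq_expect, h]

/-- Two distributions are close if no test function with values in `[0, 1]` separates them. -/
theorem tvDist_le_of_expect_le [Fintype α] {p q : PMF α} {δ : ℝ} (hδ : 0 ≤ δ)
    (h : ∀ f : α → ℝ≥0∞, (∀ a, f a ≤ 1) → q.expect f ≤ p.expect f + ENNReal.ofReal δ) :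
    tvDist p q ≤ δ := by
  classical
  have hsum (p : PMF α) : ∑ a, (p a).toReal = 1 := by
    rw [← ENNReal.toReal_sum fun a _ => p.apply_ne_top a, ← tsum_fintype (L := .unconditional _), p.tsum_coe]; rfl
  -- The indicator of `p ≤ q` is the optimal test: as both masses are 1, `q - p` on this set is the
  -- full distance.
  set f : α → ℝ≥0∞ := fun a => if (p a).toReal ≤ (q a).toReal then 1 else 0 with hf
  have key (p' : PMF α) : p'.expect f =
      ENNReal.ofReal (∑ a, (p' a).toReal * (f a).toReal) := by
    rw [expect_eq_sum, ENNReal.ofReal_sum_of_nonneg fun a _ => by positivity]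
    refine Finset.sum_congr rfl fun a _ => ?_
    rw [← ENNReal.toReal_mul, ENNReal.ofReal_toReal]
    refine ENNReal.mul_ne_top (p'.apply_ne_top a) ?_
    simp only [hf]; split_ifs <;> simp
  have h1 := h f fun a => by simp only [hf]; split_ifs <;> simp
  rw [key, key, ← ENNReal.ofReal_add (Finset.sum_nonneg fun a _ => by positivity) hδ,
    ENNReal.ofReal_le_ofReal_iff (add_nonneg (Finset.sum_nonneg fun a _ => by positivity) hδ)] at h1
  have h2 : ∀ a, |(p a).toReal - (q a).toReal| =
      2 * ((q a).toReal * (f a).toReal - (p a).toReal * (f a).toReal)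
        - ((q a).toReal - (p a).toReal) := by
    intro a
    simp only [hf]
    split_ifs with hle
    · rw [abs_of_nonpos (by linarith)]; simp; ring
    · rw [abs_of_nonneg (by linarith)]; simp
  rw [tvDist, Finset.sum_congr rfl fun a _ => h2 a]
  simp only [Finset.sum_sub_distrib, ← Finset.mul_sum, hsum]
  linarith

end expect

/-! ### Product distributions -/

section pi

variable {ι α β : Type*} [Fintype ι] [Fintype α] [Fintype β]

/-- The distribution of a family of independent random variables. -/
noncomputable def pi {ι α : Type*} [Fintype ι] [Finite α] (p : ι → PMF α) : PMF (ι → α) := by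
  classical
  haveI := Fintype.ofFinite α
  exact ofFintype (fun y => ∏ i, p i (y i)) (by
    rw [← Fintype.piFinset_univ, ← Finset.prod_univ_sum]
    refine Finset.prod_eq_one fun i _ => ?_
    rw [← tsum_fintype (L := .unconditional _), (p i).tsum_coe])

theorem pi_apply (p : ι → PMF α) (y : ι → α) : pi p y = ∏ i, p i (y i) := rfl

theorem expect_pi_prod (p : ι → PMF α) (f : ι → α → ℝ≥0∞) :
    (pi p).expect (fun y => ∏ i, f i (y i)) = ∏ i, (p i).expect (f i) := by
  classical
  simp only [expect_eq_sum, pi_apply, ← Finset.prod_mul_distrib]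
  rw [← Fintype.piFinset_univ, Finset.prod_univ_sum]

/-- Independent kernels applied coordinatewise preserve independence. This makes both reservoir
passes and the resampling argument tractable. -/
theorem pi_bind_pi (p : ι → PMF α) (k : ι → α → PMF β) :
    ((pi p).bind fun y => pi fun i => k i (y i)) = pi fun i => (p i).bind (k i) := by
  ext z
  rw [pi_apply, bind_apply]
  exact expect_pi_prod p fun i a => k i a (z i)

theorem pi_pure (y : ι → α) : pi (fun i => pure (y i)) = pure y := by
  classical
  ext z
  simp only [pi_apply, pure_apply, Finset.prod_ite_zero, Finset.prod_const_one, funext_iff,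
    Finset.mem_univ, true_imp_iff]

theorem pi_update_pure [DecidableEq ι] (y : ι → α) (i : ι) (q : PMF α) :
    pi (fun j => if j = i then q else pure (y j)) = q.map (Function.update y i) := by
  have h (x : α) : pure (Function.update y i x) =
      pi fun j => if j = i then pure x else pure (y j) := by
    rw [← pi_pure]
    congr 1; ext1 j
    by_cases hj : j = i
    · subst hj; simp
    · simp [hj]
  classical
  ext z
  simp only [map, Function.comp_def, h, bind_apply, pi_apply]
  rw [← Finset.mul_prod_erase _ _ (Finset.mem_univ i)]
  have h' (x : α) : (∏ j, (if j = i then pure x else pure (y j) : PMF α) (z j)) =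
      (pure x : PMF α) (z i) * ∏ j ∈ Finset.univ.erase i, (pure (y j) : PMF α) (z j) := by
    rw [← Finset.mul_prod_erase _ _ (Finset.mem_univ i), if_pos rfl]
    congr 1
    exact Finset.prod_congr rfl fun j hj => by rw [if_neg (Finset.ne_of_mem_erase hj)]
  simp only [h', ← mul_assoc, ENNReal.tsum_mul_right]
  rw [if_pos trivial]
  congr 1
  · rw [tsum_eq_single (z i)]
    · simp
    · intro x hx; simp [hx.symm]
  · exact Finset.prod_congr rfl fun j hj => by rw [if_neg (Finset.ne_of_mem_erase hj)]

/-- Resampling one coordinate of an independent family does not change its distribution. -/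
theorem expect_pi_resample [DecidableEq ι] (p : ι → PMF α) (i : ι) (f : (ι → α) → ℝ≥0∞) :
    (pi p).expect f = (p i).expect fun x => (pi p).expect fun y => f (Function.update y i x) := by
  -- The kernel forgets coordinate `i` and redraws it from `p i`, and keeps the other coordinates.
  have h := pi_bind_pi p fun j a => if j = i then p i else pure a
  simp only [pi_update_pure] at h
  have h' : (fun j => (p j).bind fun a => if j = i then p i else pure a) = p := by
    ext1 j
    by_cases hj : j = i
    · subst hj; simp
    · simp [hj, bind_pure]
  rw [h'] at h
  rw [expect_comm]
  conv_lhs => rw [← h]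
  simp

theorem expect_pi_eval (p : ι → PMF α) (i : ι) (f : α → ℝ≥0∞) :
    (pi p).expect (fun y => f (y i)) = (p i).expect f := by
  classical
  rw [expect_pi_resample p i]
  simp

theorem expect_pi_cons {r : ℕ} (p : Fin (r + 1) → PMF α) (f : (Fin (r + 1) → α) → ℝ≥0∞) :
    (pi p).expect f = (p 0).expect fun x =>
      (pi fun i => p i.succ).expect fun y => f (Fin.cons x y : Fin (r + 1) → α) := by
  classical
  simp only [expect_eq_sum, pi_apply, Finset.mul_sum]
  rw [← (Fin.consEquiv fun _ => α).sum_comp, Fintype.sum_prod_type]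
  simp [Fin.consEquiv, Fin.prod_univ_succ, mul_assoc]

end pi

/-! ### Uniform distributions and reservoir sampling -/

section reservoir

variable {V : Type*}

/-- A uniformly random element of `s`, or the default value `x₀` if `s` is empty. -/
noncomputable def uniformOr (s : Finset V) (x₀ : V) : PMF V := by
  classical exact if h : s.Nonempty then uniformOfFinset s h else pure x₀

theorem uniformOr_of_nonempty {s : Finset V} (h : s.Nonempty) (x₀ : V) :
    uniformOr s x₀ = uniformOfFinset s h := dif_pos h

theorem uniformOr_empty (x₀ : V) : uniformOr ∅ x₀ = pure x₀ := dif_neg (by simp)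

theorem expect_uniformOfFinset {s : Finset V} (h : s.Nonempty) (f : V → ℝ≥0∞) :
    (uniformOfFinset s h).expect f = (s.card : ℝ≥0∞)⁻¹ * ∑ a ∈ s, f a := by
  classical
  rw [expect, tsum_eq_sum (s := s)]
  · rw [Finset.mul_sum]
    exact Finset.sum_congr rfl fun a ha => by rw [uniformOfFinset_apply_of_mem h ha]
  · intro a ha
    rw [uniformOfFinset_apply_of_notMem h ha, zero_mul]

theorem card_mul_expect_uniformOr (s : Finset V) (x₀ : V) (f : V → ℝ≥0∞) :
    s.card * (uniformOr s x₀).expect f = ∑ a ∈ s, f a := by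
  rcases s.eq_empty_or_nonempty with rfl | h
  · simp
  · rw [uniformOr_of_nonempty h, expect_uniformOfFinset, ← mul_assoc, ENNReal.mul_inv_cancel,
      one_mul]
    · simpa using h.ne_empty
    · simp

/-- Reservoir sampling: having seen `m` items before, replace the current sample `x` by the new item
`w` with probability `1 / (m + 1)`. -/
noncomputable def reservoirStep (m : ℕ) (w x : V) : PMF V :=
  (uniformOfFinset (Finset.univ : Finset (Fin (m + 1))) Finset.univ_nonempty).map
    fun j => if j = 0 then w else x

theorem expect_reservoirStep (m : ℕ) (w x : V) (f : V → ℝ≥0∞) :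
    (reservoirStep m w x).expect f = ((m + 1 : ℕ) : ℝ≥0∞)⁻¹ * (f w + m * f x) := by
  rw [reservoirStep, expect_map, expect_uniformOfFinset, Fin.sum_univ_succ]
  simp

/-- The old sample survives with weight `card / (card + 1)`, which turns its average over `s` into a
sum over `s`. For empty `s` the weight is 0, so the default value disappears. -/
theorem uniformOr_bind_reservoirStep [DecidableEq V] {s : Finset V} {w : V} (hw : w ∉ s) (x₀ : V) :
    (uniformOr s x₀).bind (reservoirStep s.card w) = uniformOr (insert w s) x₀ := by
  refine ext_expect fun f => ?_
  rw [expect_bind]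
  simp only [expect_reservoirStep, expect_const_mul, expect_add, expect_const,
    card_mul_expect_uniformOr]
  rw [uniformOr_of_nonempty (Finset.insert_nonempty w s), expect_uniformOfFinset,
    Finset.card_insert_of_notMem hw, Finset.sum_insert hw]

end reservoir

end PMF

/-! ### Random walks: decompositions and escape probabilities -/

namespace Digraph

variable {V : Type*} [Fintype V] (G : Digraph V)

theorem mem_outNbrs {u v : V} : v ∈ G.outNbrs u ↔ G.Adj u v := by
  classical
  simp [outNbrs]

theorem walkStep_eq_uniformOr (u : V) : G.walkStep u = PMF.uniformOr (G.outNbrs u) u := rfl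

/-- The distribution of the `L` vertices that follow `u` on a random walk. -/
noncomputable def walkTail : (L : ℕ) → V → PMF (Fin L → V)
  | 0, _ => PMF.pure Fin.elim0
  | L + 1, u => (G.walkStep u).bind fun v =>
      (walkTail L v).map fun walk => (Fin.cons v walk : Fin (L + 1) → V)

theorem randomWalk_eq_map_walkTail (L : ℕ) (u : V) :
    G.randomWalk L u =
      (G.walkTail L u).map fun walk => (Fin.cons u walk : Fin (L + 1) → V) := by
  induction L generalizing u with
  | zero =>
    simp only [randomWalk, walkTail, PMF.pure_map]
    congr 1; ext i; rw [Fin.fin_one_eq_zero i]; rfl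
  | succ L ih =>
    simp only [randomWalk, walkTail, PMF.map_bind, ih]

/-- The probability that the walk of length `j` from `v` does not visit `u`. -/
noncomputable def avoidProb (u : V) (j : ℕ) (v : V) : ℝ≥0∞ := by
  classical exact (G.randomWalk j v).expect fun a => if ∀ i, a i ≠ u then 1 else 0

theorem avoidProb_self (u : V) (j : ℕ) : G.avoidProb u j u = 0 := by
  classical
  rw [avoidProb, randomWalk_eq_map_walkTail, PMF.expect_map]
  have h (a : Fin j → V) : ¬ ∀ i, (Fin.cons u a : Fin (j + 1) → V) i ≠ u :=
    fun h => h 0 rfl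
  simp [h]

theorem avoidProb_le_one (u : V) (j : ℕ) (v : V) : G.avoidProb u j v ≤ 1 := by
  classical
  calc G.avoidProb u j v ≤ (G.randomWalk j v).expect fun _ => 1 :=
        PMF.expect_mono _ fun a => by split_ifs <;> simp
    _ = 1 := PMF.expect_const _ _

theorem avoidProb_succ {u v : V} (h : v ≠ u) (j : ℕ) :
    G.avoidProb u (j + 1) v = (G.walkStep v).expect (G.avoidProb u j) := by
  classical
  have h' (a : Fin (j + 1) → V) :
      (∀ i, (Fin.cons v a : Fin (j + 2) → V) i ≠ u) ↔ ∀ i, a i ≠ u := by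
    rw [Fin.forall_fin_succ]
    simp [h]
  simp only [avoidProb, randomWalk, PMF.expect_bind, PMF.expect_map, h']
  rfl

theorem avoidProb_succ_le (u v : V) (j : ℕ) :
    G.avoidProb u (j + 1) v ≤ G.avoidProb u j v := by
  induction j generalizing v with
  | zero =>
    by_cases h : v = u
    · subst h; simp [avoidProb_self]
    · refine (avoidProb_le_one ..).trans ?_
      simp [avoidProb, randomWalk, h]
  | succ j ih =>
    by_cases h : v = u
    · subst h; simp [avoidProb_self]
    · rw [avoidProb_succ G h, avoidProb_succ G h]
      exact PMF.expect_mono _ ih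

theorem avoidProb_anti (u v : V) {i j : ℕ} (h : i ≤ j) : G.avoidProb u j v ≤ G.avoidProb u i v :=
  antitone_nat_of_succ_le (f := fun j => G.avoidProb u j v) (avoidProb_succ_le G u v) h

end Digraph

/-! ### Trajectories of random functions -/

/-- The trajectory of `v` under the successive application of `F 0`, `F 1`, … -/
def trajectory {V : Type*} : (r : ℕ) → (Fin r → V → V) → V → Fin (r + 1) → V
  | 0, _, v => fun _ => v
  | r + 1, F, v => Fin.cons v (trajectory r (Fin.tail F) (F 0 v))

@[simp] theorem trajectory_zero {V : Type*} (r : ℕ) (F : Fin r → V → V) (v : V) :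
    trajectory r F v 0 = v := by
  cases r <;> rfl

-- Each time step has its own random function, so a repeated visit to a vertex sees a fresh sample.
-- Trajectories from different vertices are dependent, but only their marginals matter.
open Classical in
theorem Digraph.expect_trajectory {V : Type*} [Fintype V] (G : Digraph V) (r : ℕ) (v : V)
    (f : (Fin (r + 1) → V) → ℝ≥0∞) :
    (PMF.pi fun _ : Fin r => PMF.pi G.walkStep).expect
      (fun F => f (trajectory r F v)) = (G.randomWalk r v).expect f := by
  classical
  induction r generalizing v with
  | zero => simp [trajectory, randomWalk]
  | succ r ih =>
    simp only [PMF.expect_pi_cons, trajectory, Fin.tail_cons, Fin.cons_zero, randomWalk,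
      PMF.expect_bind, PMF.expect_map]
    rw [← PMF.expect_pi_eval G.walkStep v]
    refine congrArg _ (funext fun F => ?_)
    exact ih (F v) fun walk => f (Fin.cons v walk : Fin (r + 2) → V)

/-! ### Exits along light edges -/

section exits

variable {V : Type*} (P : V → V → Prop)

/-- The number of steps of the walk from `v` through `b` that leave `u` along an edge in `P`. -/
noncomputable def exitCount (u : V) : (L : ℕ) → V → (Fin L → V) → ℕ
  | 0, _, _ => 0
  | L + 1, v, b => by classical exact
      (if v = u ∧ P v (b 0) then 1 else 0) + exitCount u L (b 0) (Fin.tail b)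

/-- Starting with the counters `c`, the walk from `v` through `b` leaves no vertex along edges in `P`
so often that its counter would exceed `T`. -/
def WithinBudget [DecidableEq V] {T : ℕ} :
    (L : ℕ) → (V → Fin (T + 1)) → V → (Fin L → V) → Prop
  | 0, _, _, _ => True
  | L + 1, c, v, b =>
      (¬ P v (b 0) → WithinBudget L c (b 0) (Fin.tail b)) ∧
      (P v (b 0) → c v < Fin.last T ∧
        WithinBudget L (Function.update c v (c v + 1)) (b 0) (Fin.tail b))

/-- A step in `P` moves one unit from the remaining exits to the counter, so the sum in the
hypothesis never grows. -/
theorem withinBudget_of_exitCount_le [DecidableEq V] {T : ℕ} (L : ℕ) (c : V → Fin (T + 1)) (v : V)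
    (b : Fin L → V) (h : ∀ u, (c u : ℕ) + exitCount P u L v b ≤ T) : WithinBudget P L c v b := by
  induction L generalizing c v with
  | zero => trivial
  | succ L ih =>
    simp only [exitCount] at h
    refine ⟨fun hP => ih _ _ _ fun u => ?_, fun hP => ?_⟩
    · have := h u
      simp only [hP, and_false, if_false] at this
      omega
    · have hv := h v
      simp only [hP, and_self, if_true] at hv
      have hlt : c v < Fin.last T := by
        rw [Fin.lt_def, Fin.val_last]; omega
      refine ⟨hlt, ih _ _ _ fun u => ?_⟩
      by_cases huv : u = v
      · subst huv
        rw [Function.update_self, Fin.val_add_one_of_lt hlt]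
        omega
      · have := h u
        rw [Function.update_of_ne huv]
        omega

variable [Fintype V] (G : Digraph V)

open Classical in
theorem expect_pow_exitCount_succ (u : V) (x : ℝ≥0∞) (L : ℕ) (v : V) :
    (G.walkTail (L + 1) v).expect (fun b => x ^ exitCount P u (L + 1) v b) =
      (G.walkStep v).expect fun w => x ^ (if v = u ∧ P v w then 1 else 0) *
        (G.walkTail L w).expect fun b => x ^ exitCount P u L w b := by
  simp only [Digraph.walkTail, exitCount, pow_add, PMF.expect_bind, PMF.expect_map, Fin.cons_zero,
    Fin.tail_cons, PMF.expect_const_mul]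

/-- If `u` is avoided with substantial probability, so that the walk uses up part of its length
before it can return to `u`, then the exponential moment of the number of exits is smaller. -/
theorem expect_pow_exitCount_add_avoidProb_le (u : V) (x Q : ℝ≥0∞) (L j : ℕ)
    (hQ : ∀ v, (G.walkTail L v).expect (fun b => x ^ exitCount P u L v b) ≤ Q)
    (hu : ∀ i ≤ j, (G.walkTail (L + i) u).expect (fun b => x ^ exitCount P u (L + i) u b) ≤ 2 * Q)
    (v : V) :
    (G.walkTail (L + j) v).expect (fun b => x ^ exitCount P u (L + j) v b)
      + G.avoidProb u j v * Q ≤ 2 * Q := by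
  classical
  induction j generalizing v with
  | zero =>
    rw [two_mul]
    exact add_le_add (hQ v) (mul_le_of_le_one_left zero_le (G.avoidProb_le_one ..))
  | succ j ih =>
    by_cases h : v = u
    -- Back at `u`, the avoidance term vanishes and only the weaker bound `2 * Q` is needed.
    · subst h
      simpa [G.avoidProb_self] using hu (j + 1) le_rfl
    · rw [← add_assoc, expect_pow_exitCount_succ, G.avoidProb_succ h, ← PMF.expect_mul_const,
        ← PMF.expect_add, ← PMF.expect_const (G.walkStep v) (2 * Q)]
      refine PMF.expect_mono _ fun w => ?_
      simpa [h] using ih (fun i hi => hu i (by omega)) w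

/-- The base `8/7` comes from here: a gain of `1/4` leaves `g ≤ (7/4) * Q`, and the factor for one
exit restores exactly `2 * Q`. -/
theorem eight_sevenths_mul_le {g Q a : ℝ≥0∞} (hQ : Q ≠ ⊤) (ha : 1 / 4 ≤ a)
    (h : g + a * Q ≤ 2 * Q) : 8 / 7 * g ≤ 2 * Q := by
  have h1 : g + 1 / 4 * Q ≤ 2 * Q := le_trans (by gcongr) h
  have hg : g ≠ ⊤ := by
    rintro rfl
    simp at h1
    exact ENNReal.mul_ne_top (by simp) hQ h1
  lift g to NNReal using hg
  lift Q to NNReal using hQ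
  have e8 : (8 / 7 : ℝ≥0∞) = ((8 / 7 : NNReal) : ℝ≥0∞) := by
    rw [ENNReal.coe_div (by norm_num)]; rfl
  have e4 : (1 / 4 : ℝ≥0∞) = ((1 / 4 : NNReal) : ℝ≥0∞) := by
    rw [ENNReal.coe_div (by norm_num)]; rfl
  have e2 : (2 : ℝ≥0∞) = ((2 : NNReal) : ℝ≥0∞) := rfl
  rw [e4, e2] at h1
  rw [e8, e2]
  norm_cast at h1 ⊢
  rw [← NNReal.coe_le_coe] at h1 ⊢
  push_cast at h1 ⊢
  linarith

/-- If every exit from `u` along an edge in `P` is followed, with probability at least `1/4`, by `r`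
steps that avoid `u`, then the exponential moment of the number of such exits is at most `2 ^ k` for
walks of length at most `k * r`. -/
theorem expect_pow_exitCount_le (u : V) (r : ℕ)
    (hP : ∀ w, P u w → 1 / 4 ≤ G.avoidProb u r w) (k L : ℕ) (hL : L ≤ k * r) (v : V) :
    (G.walkTail L v).expect (fun b => (8 / 7) ^ exitCount P u L v b) ≤ 2 ^ k := by
  classical
  induction k generalizing L v with
  | zero =>
    obtain rfl : L = 0 := by omega
    simp [Digraph.walkTail, exitCount]
  | succ k ihk =>
    -- The outer induction bounds the moment once a block of `r` steps has been used up; the inner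
    -- one bounds it after an earlier return to `u`.
    induction L using Nat.strong_induction_on generalizing v with
    | _ L ihL =>
    rcases L with _ | L
    · simp only [Digraph.walkTail, exitCount, pow_zero, PMF.expect_const]
      exact one_le_pow₀ (by norm_num)
    rw [expect_pow_exitCount_succ, ← PMF.expect_const (G.walkStep v) (2 ^ (k + 1))]
    refine PMF.expect_mono _ fun w => ?_
    have hL' : L ≤ (k + 1) * r := by omega
    have hw := ihL L (by omega) hL' w
    split_ifs with hvw
    · obtain ⟨rfl, hvw⟩ := hvw
      rw [pow_one, pow_succ']
      -- If fewer than `r` steps remain, the subtraction truncates to 0 and the whole walk lies in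
      -- the avoidance window.
      have hsplit : L = (L - r) + min L r := by omega
      have hle : L - r ≤ k * r := by
        rw [Nat.sub_le_iff_le_add]; linarith
      refine eight_sevenths_mul_le (by simp)
        ((hP w hvw).trans (G.avoidProb_anti v w (min_le_right L r))) ?_
      have := expect_pow_exitCount_add_avoidProb_le P G v (8 / 7) (2 ^ k) (L - r) (min L r)
        (fun v => ihk _ hle v)
        (fun i hi => by
          rw [← pow_succ']
          exact ihL _ (by omega) (by omega) v) w
      rwa [← hsplit] at this
    · simpa using hw

open Classical in
/-- A walk of length at most `r * r` rarely exceeds its budgets. -/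
theorem expect_not_withinBudget_le [DecidableEq V] (r T L : ℕ) (hL : L ≤ r * r)
    (hP : ∀ u w, P u w → 1 / 4 ≤ G.avoidProb u r w) (v : V) :
    (G.walkTail L v).expect (fun b => if WithinBudget P L (0 : V → Fin (T + 1)) v b then 0 else 1) ≤
      Fintype.card V * (2 ^ r * ((8 / 7) ^ T)⁻¹) := by
  classical
  have hpos : ((8 / 7 : ℝ≥0∞)) ^ T ≠ 0 := by simp
  have htop : ((8 / 7 : ℝ≥0∞)) ^ T ≠ ⊤ := by
    refine ENNReal.pow_ne_top (ENNReal.div_ne_top (by simp) (by simp))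
  have hone : (1 : ℝ≥0∞) ≤ 8 / 7 := by
    rw [ENNReal.le_div_iff_mul_le (by simp) (by simp)]; norm_num
  -- Markov's inequality for the exponential moment, with a union bound over the vertices.
  calc _ ≤ (G.walkTail L v).expect fun b => ∑ u : V,
        (8 / 7) ^ exitCount P u L v b * ((8 / 7) ^ T)⁻¹ := by
        refine PMF.expect_mono _ fun b => ?_
        split_ifs with hb
        · exact zero_le
        · obtain ⟨u, hu⟩ : ∃ u, T < exitCount P u L v b := by
            by_contra! hcon
            exact hb (withinBudget_of_exitCount_le P L 0 v b fun u => by simpa using hcon u)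
          refine le_trans ?_ (Finset.single_le_sum (fun _ _ => zero_le) (Finset.mem_univ u))
          rw [← ENNReal.mul_inv_cancel hpos htop]
          exact mul_le_mul_left (pow_le_pow_right₀ hone hu.le) _
    _ ≤ ∑ u : V, 2 ^ r * ((8 / 7) ^ T)⁻¹ := by
        rw [PMF.expect_finset_sum]
        refine Finset.sum_le_sum fun u _ => ?_
        rw [PMF.expect_mul_const]
        exact mul_le_mul_left (expect_pow_exitCount_le P G u r (hP u) r L hL v) _
    _ = _ := by simp

end exits

/-! ### Light pairs -/

/-- The pair `(a, b)` is light if none of the `K` sampled trajectories from `b` visits `a`. -/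
def IsLight {V : Type*} {K r : ℕ} (t : Fin K → Fin r → V → V) (a b : V) : Prop :=
  ∀ k i, trajectory r (t k) b i ≠ a

/-- Time 0 of a trajectory counts as a visit. Hence self-loops are heavy, and staying put at an
absorbing vertex costs no budget. -/
theorem not_isLight_self {V : Type*} {K r : ℕ} (hK : 0 < K) (t : Fin K → Fin r → V → V) (a : V) :
    ¬ IsLight t a a := fun h => h ⟨0, hK⟩ 0 (trajectory_zero ..)

/-- The distribution of `K` independent families of `r` independent samples of a step from each
vertex. -/
noncomputable def Digraph.stepTable {V : Type*} [Fintype V] (G : Digraph V) (K r : ℕ) :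
    PMF (Fin K → Fin r → V → V) :=
  PMF.pi fun _ => PMF.pi fun _ => PMF.pi G.walkStep

-- The `K` families are independent, and each avoids `a` with the probability of a true `r`-step
-- walk.
open Classical in
theorem Digraph.expect_isLight {V : Type*} [Fintype V] (G : Digraph V) (K r : ℕ) (a b : V) :
    (G.stepTable K r).expect (fun t => if IsLight t a b then 1 else 0) =
      G.avoidProb a r b ^ K := by
  classical
  have h (t : Fin K → Fin r → V → V) : (if IsLight t a b then 1 else 0 : ℝ≥0∞) =
      ∏ k, if ∀ i, trajectory r (t k) b i ≠ a then 1 else 0 := by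
    simp only [Finset.prod_ite_zero, IsLight, Finset.prod_const_one, Finset.mem_univ,
      true_imp_iff]
    congr
  simp only [h, stepTable]
  rw [PMF.expect_pi_prod _ fun _ F => if ∀ i, trajectory r F b i ≠ a then (1 : ℝ≥0∞) else 0]
  rw [avoidProb, Finset.prod_const, Finset.card_univ, Fintype.card_fin]
  congr 1
  exact G.expect_trajectory r b fun x => if ∀ i, x i ≠ a then (1 : ℝ≥0∞) else 0

open Classical in
/-- With high probability, all light pairs are such that the walk from the second vertex avoids the
first one with substantial probability. -/
theorem Digraph.expect_exists_isLight_le {V : Type*} [Fintype V] (G : Digraph V) (K r : ℕ) :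
    (G.stepTable K r).expect
      (fun t => if ∀ a b, IsLight t a b → 1 / 4 ≤ G.avoidProb a r b then 0 else 1) ≤
      Fintype.card V * Fintype.card V * (1 / 4) ^ K := by
  classical
  calc _ ≤ (G.stepTable K r).expect fun t => ∑ p : V × V,
        (if IsLight t p.1 p.2 then 1 else 0) * (if 1 / 4 ≤ G.avoidProb p.1 r p.2 then 0 else 1) := by
        refine PMF.expect_mono _ fun t => ?_
        split_ifs with h
        · exact zero_le
        · push Not at h
          obtain ⟨a, b, hl, ha⟩ := h
          refine le_trans ?_
            (Finset.single_le_sum (fun _ _ => zero_le) (Finset.mem_univ (a, b)))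
          simp only [if_pos hl, if_neg ha.not_ge, mul_one, le_refl]
    _ ≤ ∑ _p : V × V, (1 / 4) ^ K := by
        rw [PMF.expect_finset_sum]
        refine Finset.sum_le_sum fun p _ => ?_
        rw [PMF.expect_mul_const, G.expect_isLight]
        split_ifs with h
        · simp
        · rw [mul_one]
          exact pow_le_pow_left₀ zero_le (not_le.mp h).le _
    _ = _ := by simp

/-! ### Output of a streaming algorithm -/

namespace ObliviousStreamingAlgorithm

variable {n p : ℕ} (A : ObliviousStreamingAlgorithm n p)

/-- The next `L` vertices that the sampling phase writes to the output tape. -/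
noncomputable def emission (M : A.Msg) (u : Fin n) : (L : ℕ) → A.Work → PMF (Fin L → Fin n)
  | 0, _ => PMF.pure Fin.elim0
  | L + 1, c => (A.next M u c).bind fun r =>
      (emission M u L r.2).map fun walk => (Fin.cons r.1 walk : Fin (L + 1) → Fin n)

theorem emit_eq_emission (M : A.Msg) (u : Fin n) (L : ℕ) (c : A.Work) :
    A.emit M u L c = A.emission M u (L + 1) c := by
  induction L generalizing c with
  | zero =>
    simp only [emit, emission, PMF.pure_map]
    rw [PMF.map]
    congr 1
    ext1 r
    rw [Function.comp_apply]
    congr 1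
    ext1 i
    rw [Fin.fin_one_eq_zero i]; rfl
  | succ L ih =>
    rw [emit, emission]
    simp only [ih]

theorem expect_emission_succ (M : A.Msg) (u : Fin n) (L : ℕ) (c : A.Work)
    (f : (Fin (L + 1) → Fin n) → ℝ≥0∞) :
    (A.emission M u (L + 1) c).expect f = (A.next M u c).expect fun r =>
      (A.emission M u L r.2).expect fun walk => f (Fin.cons r.1 walk : Fin (L + 1) → Fin n) := by
  simp [emission]

end ObliviousStreamingAlgorithm

/-! ### The algorithm -/

namespace TwoPassWalk

open Classical

variable {n : ℕ}

/-- Memory of the preprocessing phase. -/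
structure Memory (n K r T : ℕ) where
  /-- whether the second pass has begun -/
  second : Bool
  /-- samples of the out-edges, from the first pass -/
  table : Fin K → Fin r → Fin n → Fin n
  /-- number of sampled out-edges of each vertex that were read in the current pass -/
  count : Fin n → Fin (n + 1)
  /-- whether the edge from `trajectory r (table k) b i` to `b` was read in the second pass -/
  seen : Fin n → Fin K → Fin (r + 1) → Bool
  /-- samples of the light out-edges, from the second pass -/
  samples : Fin n × Fin T → Fin n

/-- Reservoir sampling for a slot that belongs to the vertex `v`, on reading the edge `e`. -/
noncomputable def slotUpdate (count : Fin n → Fin (n + 1)) (e : Fin n × Fin n) (v x : Fin n) :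
    PMF (Fin n) :=
  if v = e.1 then PMF.reservoirStep (count e.1) e.2 x else PMF.pure x

/-- Increment the counter of the tail of `e`. -/
def bump (count : Fin n → Fin (n + 1)) (e : Fin n × Fin n) : Fin n → Fin (n + 1) :=
  Function.update count e.1 (count e.1 + 1)

variable {K r T : ℕ}

/-- Record the edge `e` as seen. -/
noncomputable def record (m : Memory n K r T) (e : Fin n × Fin n) :
    Fin n → Fin K → Fin (r + 1) → Bool :=
  fun b k i => m.seen b k i || decide ((trajectory r (m.table k) b i, b) = e)

/-- Reading an edge. In the first pass all edges are sampled. In the second pass the heavy edges are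
recorded and the light edges are sampled. -/
noncomputable def readEdge (m : Memory n K r T) (e : Fin n × Fin n) : PMF (Memory n K r T) :=
  if m.second = false then
    (PMF.pi fun k => PMF.pi fun i => PMF.pi fun v => slotUpdate m.count e v (m.table k i v)).map
      fun t => { m with table := t, count := bump m.count e }
  else if IsLight m.table e.1 e.2 then
    (PMF.pi fun s => slotUpdate m.count e s.1 (m.samples s)).map
      fun y => { m with samples := y, count := bump m.count e }
  else
    PMF.pure { m with seen := record m e }

/-- The recorded heavy out-neighbours of `v`. -/
noncomputable def heavyOut (m : Memory n K r T) (v : Fin n) : Finset (Fin n) :=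
  Finset.univ.filter fun w => ∃ k i, trajectory r (m.table k) w i = v ∧ m.seen w k i

/-- Memory of the sampling phase: the current vertex, and the number of samples of light edges
that were used so far. -/
abbrev Position (n T : ℕ) := Option (Fin n × (Fin n → Fin (T + 1)))

/-- Leave `v` along the next sampled light edge; if there is none left, give up. -/
def lightStep (m : Memory n K r T) (v : Fin n) (c : Fin n → Fin (T + 1)) :
    Fin n × Position n T :=
  if h : (c v : ℕ) < T then
    (m.samples (v, ⟨c v, h⟩), some (m.samples (v, ⟨c v, h⟩), Function.update c v (c v + 1)))
  else (v, some (v, c))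

/-- One step of the sampling phase. -/
noncomputable def sampleStep (m : Memory n K r T) (u : Fin n) :
    Position n T → PMF (Fin n × Position n T)
  -- Before the first output the position is `none`; this step writes the starting vertex itself.
  | none => PMF.pure (u, some (u, 0))
  | some (v, c) =>
      (PMF.uniformOr (((heavyOut m v).disjSum (Finset.univ : Finset (Fin (m.count v)))).map
        Function.Embedding.some) none).map fun o =>
          match o with
          | none => (v, some (v, c))
          | some (Sum.inl w) => (w, some (w, c))
          | some (Sum.inr _) => lightStep m v c

/-- The two-pass algorithm: in the first pass `K` families of `r` samples are drawn for each vertex,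
in the second pass `T` samples of the light edges. -/
noncomputable abbrev algorithm (n K r T : ℕ) : ObliviousStreamingAlgorithm n 2 where
  Mem := Memory n K r T
  Msg := Memory n K r T
  Work := Position n T
  init := ⟨false, fun _ _ v => v, 0, fun _ _ _ => false, fun s => s.1⟩
  update := readEdge
  -- Counters are reset only after the first pass; after the second they hold the light out-degrees
  -- that the sampling phase needs.
  endPass m := PMF.pure (if m.second then m else { m with second := true, count := 0 })
  message m := m
  start := none
  next := sampleStep

/-! ### Analysis of the preprocessing phase -/

/-- The heads of the edges in `E` that leave `v` and satisfy `P`. -/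
noncomputable def heads (P : Fin n → Fin n → Prop) (E : Finset (Fin n × Fin n)) (v : Fin n) :
    Finset (Fin n) :=
  Finset.univ.filter fun w => (v, w) ∈ E ∧ P v w

/-- The counters after reading the edges in `E`. -/
noncomputable def headCount (P : Fin n → Fin n → Prop) (E : Finset (Fin n × Fin n)) (v : Fin n) :
    Fin (n + 1) :=
  Fin.ofNat (n + 1) (heads P E v).card

/-- Out-degrees are at most `n`, so a counter modulo `n + 1` never wraps around. -/
theorem headCount_val (P : Fin n → Fin n → Prop) (E : Finset (Fin n × Fin n)) (v : Fin n) :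
    (headCount P E v : ℕ) = (heads P E v).card := by
  have : (heads P E v).card ≤ n := (Finset.card_le_univ _).trans_eq (Fintype.card_fin n)
  simp only [headCount, Fin.val_ofNat]
  exact Nat.mod_eq_of_lt (by omega)

variable {P : Fin n → Fin n → Prop} {E : Finset (Fin n × Fin n)} {e : Fin n × Fin n}

theorem heads_empty (v : Fin n) : heads P ∅ v = ∅ := by simp [heads]

theorem headCount_empty : headCount P ∅ = 0 := by
  ext v
  simp [headCount_val, heads_empty]

theorem heads_insert_of_not (h : ¬ P e.1 e.2) : heads P (insert e E) = heads P E := by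
  ext v w
  simp only [heads, Finset.mem_filter, Finset.mem_univ, true_and, Finset.mem_insert]
  constructor
  · rintro ⟨rfl | h', hP⟩
    · exact absurd hP h
    · exact ⟨h', hP⟩
  · rintro ⟨h', hP⟩
    exact ⟨Or.inr h', hP⟩

theorem heads_insert_of_ne {v : Fin n} (h : v ≠ e.1) : heads P (insert e E) v = heads P E v := by
  ext w
  have : (v, w) ≠ e := fun h' => h (by rw [← h'])
  simp [heads, this]

theorem heads_insert_self (h : P e.1 e.2) :
    heads P (insert e E) e.1 = insert e.2 (heads P E e.1) := by
  ext w
  simp only [heads, Finset.mem_filter, Finset.mem_univ, true_and, Finset.mem_insert, Prod.ext_iff]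
  constructor
  · rintro ⟨h' | h', hP⟩
    · exact Or.inl h'
    · exact Or.inr ⟨h', hP⟩
  · rintro (rfl | ⟨h', hP⟩)
    · exact ⟨Or.inl rfl, h⟩
    · exact ⟨Or.inr h', hP⟩

theorem notMem_heads (h : e ∉ E) : e.2 ∉ heads P E e.1 := by
  simp [heads, h]

theorem bump_headCount (he : e ∉ E) (h : P e.1 e.2) :
    bump (headCount P E) e = headCount P (insert e E) := by
  ext1 v
  by_cases hv : v = e.1
  · subst hv
    rw [bump, Function.update_self, headCount, headCount, heads_insert_self h,
      Finset.card_insert_of_notMem (notMem_heads he)]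
    ext
    simp [Fin.ofNat, Fin.add_def]
  · rw [bump, Function.update_of_ne hv, headCount, headCount, heads_insert_of_ne hv]

theorem uniformOr_bind_slotUpdate (he : e ∉ E) (h : P e.1 e.2) (v : Fin n) :
    (PMF.uniformOr (heads P E v) v).bind (slotUpdate (headCount P E) e v) =
      PMF.uniformOr (heads P (insert e E) v) v := by
  unfold slotUpdate
  by_cases hv : v = e.1
  · subst hv
    simp only [if_true, headCount_val]
    rw [PMF.uniformOr_bind_reservoirStep (notMem_heads he), heads_insert_self h]
  · simp only [if_neg hv, heads_insert_of_ne hv]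
    exact PMF.bind_pure _

/-- Distribution of the samples of the first pass after reading the edges in `E`. -/
noncomputable def tableDist (K r : ℕ) (E : Finset (Fin n × Fin n)) :
    PMF (Fin K → Fin r → Fin n → Fin n) :=
  PMF.pi fun _ => PMF.pi fun _ => PMF.pi fun v => PMF.uniformOr (heads (fun _ _ => True) E v) v

/-- Distribution of the samples of the second pass after reading the edges in `E`. -/
noncomputable def sampleDist (T : ℕ) (P : Fin n → Fin n → Prop) (E : Finset (Fin n × Fin n)) :
    PMF (Fin n × Fin T → Fin n) :=
  PMF.pi fun s => PMF.uniformOr (heads P E s.1) s.1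

/-- Configuration in the first pass after reading the edges in `E`. -/
noncomputable def firstState (T : ℕ) (E : Finset (Fin n × Fin n))
    (t : Fin K → Fin r → Fin n → Fin n) : Memory n K r T :=
  ⟨false, t, headCount (fun _ _ => True) E, fun _ _ _ => false, fun s => s.1⟩

/-- Configuration in the second pass after reading the edges in `E`. -/
noncomputable def secondState (t : Fin K → Fin r → Fin n → Fin n) (E : Finset (Fin n × Fin n))
    (y : Fin n × Fin T → Fin n) : Memory n K r T :=
  ⟨true, t, headCount (IsLight t) E, fun b k i => decide ((trajectory r (t k) b i, b) ∈ E), y⟩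

/-- All slots are updated independently, so the product of reservoirs for `E` becomes the product
for `insert e E`; the counters depend on `E` alone. -/
theorem tableDist_bind_readEdge (he : e ∉ E) :
    ((tableDist K r E).bind fun t => readEdge (firstState T E t) e) =
      (tableDist K r (insert e E)).map (firstState T (insert e E)) := by
  have h : ∀ t : Fin K → Fin r → Fin n → Fin n, readEdge (firstState T E t) e =
      (PMF.pi fun k => PMF.pi fun i => PMF.pi fun v =>
        slotUpdate (headCount (fun _ _ => True) E) e v (t k i v)).map
        (firstState T (insert e E)) := by
    intro t
    simp only [readEdge, firstState, if_true, bump_headCount (P := fun _ _ => True) he trivial]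
    rfl
  simp only [h, ← PMF.map_bind]
  congr 1
  unfold tableDist
  rw [PMF.pi_bind_pi _ fun _ (x : Fin r → Fin n → Fin n) => PMF.pi fun i => PMF.pi fun v =>
        slotUpdate (headCount (fun _ _ => True) E) e v (x i v)]
  congr 1; ext1 k
  rw [PMF.pi_bind_pi _ fun _ (x : Fin n → Fin n) => PMF.pi fun v =>
        slotUpdate (headCount (fun _ _ => True) E) e v (x v)]
  congr 1; ext1 i
  rw [PMF.pi_bind_pi]
  congr 1; ext1 v
  exact uniformOr_bind_slotUpdate he trivial v

/-- With the table fixed, lightness is a fixed relation: a light edge affects only the reservoirs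
and counters, a heavy one only the recorded bits. -/
theorem sampleDist_bind_readEdge (t : Fin K → Fin r → Fin n → Fin n) (he : e ∉ E) :
    ((sampleDist T (IsLight t) E).bind fun y => readEdge (secondState t E y) e) =
      (sampleDist T (IsLight t) (insert e E)).map (secondState t (insert e E)) := by
  by_cases hl : IsLight t e.1 e.2
  · have h : ∀ y : Fin n × Fin T → Fin n, readEdge (secondState t E y) e =
        (PMF.pi fun s => slotUpdate (headCount (IsLight t) E) e s.1 (y s)).map
          (secondState t (insert e E)) := by
      intro y
      -- A light edge lies at no trajectory position, so no bit changes.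
      have hs : (fun b k i => decide ((trajectory r (t k) b i, b) ∈ insert e E)) =
          fun b k i => decide ((trajectory r (t k) b i, b) ∈ E) := by
        ext b k i
        have : (trajectory r (t k) b i, b) ≠ e := by
          rintro rfl
          exact hl k i rfl
        simp [this]
      unfold secondState
      rw [readEdge, if_neg (by simp), if_pos hl, ← bump_headCount he hl, hs]
    simp only [h, ← PMF.map_bind]
    congr 1
    unfold sampleDist
    rw [PMF.pi_bind_pi _ fun s : Fin n × Fin T => slotUpdate (headCount (IsLight t) E) e s.1]
    congr 1; ext1 s
    exact uniformOr_bind_slotUpdate he hl s.1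
  · have h : ∀ y : Fin n × Fin T → Fin n, readEdge (secondState t E y) e =
        PMF.pure (secondState t (insert e E) y) := by
      intro y
      unfold secondState
      rw [readEdge, if_neg (by simp), if_neg hl]
      have hc : headCount (IsLight t) (insert e E) = headCount (IsLight t) E := by
        ext1 v; rw [headCount, headCount, heads_insert_of_not hl]
      rw [hc]
      congr 2
      ext b k i
      simp [record, Bool.or_comm]
    simp only [h, sampleDist, heads_insert_of_not hl]
    rfl

theorem runPass_first (s : List (Fin n × Fin n)) (hs : s.Nodup) (E : Finset (Fin n × Fin n))
    (hE : ∀ e ∈ s, e ∉ E) :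
    ((tableDist K r E).bind fun t => (algorithm n K r T).runPass s (firstState T E t)) =
      (tableDist K r (E ∪ s.toFinset)).map fun t => secondState t ∅ fun s => s.1 := by
  induction s generalizing E with
  | nil =>
    simp only [ObliviousStreamingAlgorithm.runPass, List.toFinset_nil, Finset.union_empty]
    rw [PMF.map]
    congr 1
    ext1 t
    simp [firstState, secondState, headCount_empty]
  | cons e s ih =>
    rw [List.nodup_cons] at hs
    have he : e ∉ E := hE e (by simp)
    have := ih hs.2 (insert e E) fun e' he' => by
      rw [Finset.mem_insert, not_or]
      exact ⟨fun h => hs.1 (h ▸ he'), hE e' (by simp [he'])⟩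
    rw [List.toFinset_cons, Finset.union_insert, ← Finset.insert_union, ← this]
    simp only [ObliviousStreamingAlgorithm.runPass]
    rw [← PMF.bind_bind]
    change (((tableDist K r E).bind fun t => readEdge (firstState T E t) e).bind _) = _
    rw [tableDist_bind_readEdge he, PMF.bind_map]
    rfl

theorem runPass_second (t : Fin K → Fin r → Fin n → Fin n) (s : List (Fin n × Fin n))
    (hs : s.Nodup) (E : Finset (Fin n × Fin n)) (hE : ∀ e ∈ s, e ∉ E) :
    ((sampleDist T (IsLight t) E).bind fun y =>
        (algorithm n K r T).runPass s (secondState t E y)) =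
      (sampleDist T (IsLight t) (E ∪ s.toFinset)).map (secondState t (E ∪ s.toFinset)) := by
  induction s generalizing E with
  | nil =>
    simp only [ObliviousStreamingAlgorithm.runPass, List.toFinset_nil, Finset.union_empty]
    rw [PMF.map]
    rfl
  | cons e s ih =>
    rw [List.nodup_cons] at hs
    have he : e ∉ E := hE e (by simp)
    have := ih hs.2 (insert e E) fun e' he' => by
      rw [Finset.mem_insert, not_or]
      exact ⟨fun h => hs.1 (h ▸ he'), hE e' (by simp [he'])⟩
    rw [List.toFinset_cons, Finset.union_insert, ← Finset.insert_union, ← this]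
    simp only [ObliviousStreamingAlgorithm.runPass]
    rw [← PMF.bind_bind]
    change (((sampleDist T (IsLight t) E).bind fun y => readEdge (secondState t E y) e).bind _) = _
    rw [sampleDist_bind_readEdge t he, PMF.bind_map]
    rfl

theorem tableDist_empty : tableDist K r (∅ : Finset (Fin n × Fin n)) = PMF.pure fun _ _ v => v := by
  simp only [tableDist, heads_empty, PMF.uniformOr_empty]
  rw [PMF.pi_pure fun v => v, PMF.pi_pure fun _ v => v]
  exact PMF.pi_pure fun (_ : Fin K) (_ : Fin r) (v : Fin n) => v

theorem sampleDist_empty : sampleDist T P ∅ = PMF.pure fun s => s.1 := by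
  simp only [sampleDist, heads_empty, PMF.uniformOr_empty]
  rw [PMF.pi_pure fun s : Fin n × Fin T => s.1]

theorem heads_edgeStream {G : Digraph (Fin n)} {s : List (Fin n × Fin n)} (hs : G.IsEdgeStream s)
    (v w : Fin n) : w ∈ heads P s.toFinset v ↔ G.Adj v w ∧ P v w := by
  simp [heads, hs.2]

/-- The distribution of the message. -/
theorem preprocess_algorithm {G : Digraph (Fin n)} {s : List (Fin n × Fin n)}
    (hs : G.IsEdgeStream s) :
    (algorithm n K r T).preprocess s = (G.stepTable K r).bind fun t =>
      (sampleDist T (IsLight t) s.toFinset).map (secondState t s.toFinset) := by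
  have h1 := runPass_first (K := K) (r := r) (T := T) s hs.1 ∅ (by simp)
  rw [tableDist_empty, PMF.pure_bind, Finset.empty_union] at h1
  have hinit : (algorithm n K r T).init = firstState T ∅ fun _ _ v => v := by
    simp [firstState, headCount_empty]
  have htable : tableDist K r s.toFinset = G.stepTable K r := by
    unfold tableDist Digraph.stepTable
    congr 1; ext1 _; congr 1; ext1 _; congr 1; ext1 v
    rw [G.walkStep_eq_uniformOr]
    congr 1
    ext w
    rw [heads_edgeStream hs, G.mem_outNbrs, and_true]
  have h2 (t : Fin K → Fin r → Fin n → Fin n) :=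
    runPass_second (T := T) t s hs.1 ∅ (by simp)
  simp only [sampleDist_empty, PMF.pure_bind, Finset.empty_union] at h2
  have h3 : (algorithm n K r T).preprocess s =
      ((algorithm n K r T).runPass s (firstState T ∅ fun _ _ v => v)).bind
        ((algorithm n K r T).runPass s) := by
    rw [← hinit]
    exact (PMF.map_id _).trans
      (congrArg (PMF.bind _) (funext fun m => PMF.bind_pure _))
  rw [h3, h1, htable, PMF.bind_map]
  exact congrArg (PMF.bind _) (funext h2)

/-! ### Analysis of the sampling phase -/

/-- Every heavy edge has a position that carries its bit, so no heavy edge is lost. -/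
theorem heavyOut_secondState (t : Fin K → Fin r → Fin n → Fin n) (E : Finset (Fin n × Fin n))
    (y : Fin n × Fin T → Fin n) (v : Fin n) :
    heavyOut (secondState t E y) v = heads (fun a b => ¬ IsLight t a b) E v := by
  ext w
  simp only [heavyOut, secondState, heads, IsLight, Finset.mem_filter, Finset.mem_univ, true_and,
    decide_eq_true_eq, ne_eq, not_forall, not_not]
  constructor
  · rintro ⟨k, i, rfl, h⟩
    exact ⟨h, k, i, rfl⟩
  · rintro ⟨h, k, i, rfl⟩
    exact ⟨k, i, rfl, h⟩

theorem expect_sampleStep_some (t : Fin K → Fin r → Fin n → Fin n) (E : Finset (Fin n × Fin n))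
    (y : Fin n × Fin T → Fin n) (u v : Fin n) (c : Fin n → Fin (T + 1))
    (f : Fin n × Position n T → ℝ≥0∞) :
    (sampleStep (secondState t E y) u (some (v, c))).expect f =
      if (heads (fun a b => ¬ IsLight t a b) E v).card + (heads (IsLight t) E v).card = 0 then
        f (v, some (v, c))
      else (((heads (fun a b => ¬ IsLight t a b) E v).card +
          (heads (IsLight t) E v).card : ℕ) : ℝ≥0∞)⁻¹ *
        (∑ w ∈ heads (fun a b => ¬ IsLight t a b) E v, f (w, some (w, c)) +
          (heads (IsLight t) E v).card * f (lightStep (secondState t E y) v c)) := by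
  have hcount : ((secondState t E y).count v : ℕ) = (heads (IsLight t) E v).card :=
    headCount_val ..
  have hcard : (((heavyOut (secondState t E y) v).disjSum
      (Finset.univ : Finset (Fin ((secondState t E y).count v)))).map
        Function.Embedding.some).card =
      (heads (fun a b => ¬ IsLight t a b) E v).card + (heads (IsLight t) E v).card := by
    rw [Finset.card_map, Finset.card_disjSum, heavyOut_secondState, Finset.card_univ,
      Fintype.card_fin, hcount]
  rw [sampleStep, PMF.expect_map]
  split_ifs with h
  · rw [h, Finset.card_eq_zero] at hcard
    rw [hcard, PMF.uniformOr_empty, PMF.expect_pure]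
  · rw [PMF.uniformOr_of_nonempty (Finset.card_ne_zero.mp (by rwa [hcard])),
      PMF.expect_uniformOfFinset, hcard, Finset.sum_map, Finset.sum_disjSum, heavyOut_secondState]
    simp only [Function.Embedding.some_apply, Finset.sum_const, Finset.card_univ, Fintype.card_fin,
      hcount, nsmul_eq_mul]

/-- The uniform distribution on all edges is a mixture of those on the heavy and the light ones. -/
theorem expect_walkStep {G : Digraph (Fin n)} {s : List (Fin n × Fin n)} (hs : G.IsEdgeStream s)
    (P : Fin n → Fin n → Prop) (v : Fin n) (f : Fin n → ℝ≥0∞) :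
    (G.walkStep v).expect f =
      if (heads (fun a b => ¬ P a b) s.toFinset v).card + (heads P s.toFinset v).card = 0 then f v
      else (((heads (fun a b => ¬ P a b) s.toFinset v).card +
          (heads P s.toFinset v).card : ℕ) : ℝ≥0∞)⁻¹ *
        (∑ w ∈ heads (fun a b => ¬ P a b) s.toFinset v, f w +
          (heads P s.toFinset v).card *
            (PMF.uniformOr (heads P s.toFinset v) v).expect f) := by
  have hdisj : Disjoint (heads (fun a b => ¬ P a b) s.toFinset v) (heads P s.toFinset v) := by
    rw [Finset.disjoint_left]
    intro w hw hw'
    rw [heads_edgeStream hs] at hw hw'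
    exact hw.2 hw'.2
  have hunion : G.outNbrs v =
      heads (fun a b => ¬ P a b) s.toFinset v ∪ heads P s.toFinset v := by
    ext w
    rw [Finset.mem_union, heads_edgeStream hs, heads_edgeStream hs, G.mem_outNbrs]
    tauto
  rw [G.walkStep_eq_uniformOr, PMF.card_mul_expect_uniformOr, ← Finset.sum_union hdisj,
    ← Finset.card_union_of_disjoint hdisj, ← hunion]
  split_ifs with h
  · rw [Finset.card_eq_zero.mp h, PMF.uniformOr_empty, PMF.expect_pure]
  · rw [PMF.uniformOr_of_nonempty (Finset.card_ne_zero.mp h), PMF.expect_uniformOfFinset]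

/-- The sampling phase reads only those samples that were not used before. -/
theorem emission_congr (t : Fin K → Fin r → Fin n → Fin n) (E : Finset (Fin n × Fin n))
    (u : Fin n) (L : ℕ) (y y' : Fin n × Fin T → Fin n) (v : Fin n) (c : Fin n → Fin (T + 1))
    (h : ∀ s : Fin n × Fin T, (c s.1 : ℕ) ≤ s.2 → y s = y' s) (f : (Fin L → Fin n) → ℝ≥0∞) :
    ((algorithm n K r T).emission (secondState t E y) u L (some (v, c))).expect f =
      ((algorithm n K r T).emission (secondState t E y') u L (some (v, c))).expect f := by
  induction L generalizing v c with
  | zero => rfl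
  | succ L ih =>
    rw [ObliviousStreamingAlgorithm.expect_emission_succ,
      ObliviousStreamingAlgorithm.expect_emission_succ]
    change (sampleStep (secondState t E y) u (some (v, c))).expect _ =
      (sampleStep (secondState t E y') u (some (v, c))).expect _
    rw [expect_sampleStep_some, expect_sampleStep_some]
    have hl : ((algorithm n K r T).emission (secondState t E y) u L
          (lightStep (secondState t E y) v c).2).expect
          (fun walk => f (Fin.cons (lightStep (secondState t E y) v c).1 walk)) =
        ((algorithm n K r T).emission (secondState t E y') u L
          (lightStep (secondState t E y') v c).2).expect
          (fun walk => f (Fin.cons (lightStep (secondState t E y') v c).1 walk)) := by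
      unfold lightStep
      split_ifs with hc
      · have hy : y (v, ⟨c v, hc⟩) = y' (v, ⟨c v, hc⟩) := h _ le_rfl
        simp only [secondState, hy]
        refine ih _ _ (fun s hs => h s (le_trans ?_ hs)) _
        by_cases hv : s.1 = v
        · rw [hv, Function.update_self,
            Fin.val_add_one_of_lt (by rw [Fin.lt_def, Fin.val_last]; exact hc)]
          omega
        · rw [Function.update_of_ne hv]
      · exact ih _ _ h _
    simp only [ih _ _ h, hl]

/-- On walks that stay within their budgets, the output of the sampling phase is at least as likely
as under the random walk. -/
theorem expect_walkTail_le_expect_emission {G : Digraph (Fin n)} {s : List (Fin n × Fin n)}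
    (hs : G.IsEdgeStream s) (hK : 0 < K) (t : Fin K → Fin r → Fin n → Fin n) (u : Fin n) (L : ℕ)
    (v : Fin n) (c : Fin n → Fin (T + 1)) (f : (Fin L → Fin n) → ℝ≥0∞) :
    (G.walkTail L v).expect (fun b => if WithinBudget (IsLight t) L c v b then f b else 0) ≤
      (sampleDist T (IsLight t) s.toFinset).expect fun y =>
        ((algorithm n K r T).emission (secondState t s.toFinset y) u L (some (v, c))).expect f := by
  induction L generalizing v c with
  | zero => simp [Digraph.walkTail, WithinBudget, ObliviousStreamingAlgorithm.emission]
  | succ L ih =>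
    simp only [ObliviousStreamingAlgorithm.expect_emission_succ]
    simp only [expect_sampleStep_some, Digraph.walkTail, PMF.expect_bind, PMF.expect_map]
    rw [expect_walkStep hs (IsLight t)]
    have hheavy (w : Fin n) (hw : ¬ IsLight t v w) :
        ((G.walkTail L w).expect fun b =>
          if WithinBudget (IsLight t) (L + 1) c v (Fin.cons w b) then f (Fin.cons w b) else 0) ≤
        (sampleDist T (IsLight t) s.toFinset).expect fun y =>
          ((algorithm n K r T).emission (secondState t s.toFinset y) u L (some (w, c))).expect
            fun b => f (Fin.cons w b) := by
      refine le_trans (le_of_eq ?_) (ih w c fun b => f (Fin.cons w b))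
      simp [WithinBudget, hw]
    have hlight (w : Fin n) (hw : IsLight t v w) (hc : c v < Fin.last T) :
        ((G.walkTail L w).expect fun b =>
          if WithinBudget (IsLight t) (L + 1) c v (Fin.cons w b) then f (Fin.cons w b) else 0) ≤
        (sampleDist T (IsLight t) s.toFinset).expect fun y =>
          ((algorithm n K r T).emission (secondState t s.toFinset y) u L
            (some (w, Function.update c v (c v + 1)))).expect
            fun b => f (Fin.cons w b) := by
      refine le_trans (le_of_eq ?_)
        (ih w (Function.update c v (c v + 1)) fun b => f (Fin.cons w b))
      simp [WithinBudget, hw, hc]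
    split_ifs with h
    -- No out-edges: both processes stay at `v`, and this step counts as heavy.
    · exact hheavy v (not_isLight_self hK t v)
    · rw [PMF.expect_const_mul, PMF.expect_add, PMF.expect_finset_sum, PMF.expect_const_mul]
      refine mul_le_mul_right (add_le_add (Finset.sum_le_sum fun w hw => ?_) ?_) _
      · rw [heads_edgeStream hs] at hw
        exact hheavy w hw.2
      · rw [PMF.card_mul_expect_uniformOr]
        by_cases hc : c v < Fin.last T
        · have hcT : (c v : ℕ) < T := by rwa [Fin.lt_def, Fin.val_last] at hc
          refine (Finset.sum_le_sum fun w hw =>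
            hlight w ((heads_edgeStream hs v w).mp hw).2 hc).trans ?_
          rw [← PMF.card_mul_expect_uniformOr _ v]
          refine mul_le_mul_right (le_of_eq ?_) _
          -- Deferred decision: redraw the sample used now. Later steps read only indices from `c v
          -- + 1` on at `v`, so the rest of the output does not see the redrawn value.
          rw [sampleDist, PMF.expect_pi_resample _ (v, ⟨c v, hcT⟩) (fun y =>
            ((algorithm n K r T).emission (secondState t s.toFinset y) u L
              (lightStep (secondState t s.toFinset y) v c).2).expect fun walk =>
                f (Fin.cons (lightStep (secondState t s.toFinset y) v c).1 walk))]
          congr 1; ext1 w; congr 1; ext1 y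
          simp only [lightStep, dif_pos hcT, secondState, Function.update_self]
          refine emission_congr t s.toFinset u L y _ w _ (fun s' hs' => ?_) _
          rw [Function.update_of_ne]
          rintro rfl
          simp only [Function.update_self, Fin.val_add_one_of_lt hc] at hs'
          omega
        -- With the samples at `v` exhausted, every light exit violates the budget and the left side
        -- is 0, whatever is output.
        · refine le_trans (le_of_eq ?_) zero_le
          refine Finset.sum_eq_zero fun w hw => ?_
          have hw := ((heads_edgeStream hs v w).mp hw).2
          simp [WithinBudget, hw, hc]

/-- The output distribution is close to the random walk. -/
theorem tvDist_output_le {G : Digraph (Fin n)} {s : List (Fin n × Fin n)} (hs : G.IsEdgeStream s)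
    (hK : 0 < K) (L : ℕ) (hL : L ≤ r * r) (u : Fin n) {δ : ℝ} (hδ : 0 ≤ δ)
    (h : (n : ℝ≥0∞) * n * (1 / 4) ^ K + n * (2 ^ r * ((8 / 7) ^ T)⁻¹) ≤ ENNReal.ofReal δ) :
    PMF.tvDist ((algorithm n K r T).output s u L) (G.randomWalk L u) ≤ δ := by
  refine PMF.tvDist_le_of_expect_le hδ fun f hf => ?_
  have hout : ((algorithm n K r T).output s u L).expect f =
      (G.stepTable K r).expect fun t => (sampleDist T (IsLight t) s.toFinset).expect fun y =>
        ((algorithm n K r T).emission (secondState t s.toFinset y) u L (some (u, 0))).expect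
          fun b => f (Fin.cons u b) := by
    rw [ObliviousStreamingAlgorithm.output, preprocess_algorithm hs]
    simp only [PMF.expect_bind, ObliviousStreamingAlgorithm.emit_eq_emission,
      ObliviousStreamingAlgorithm.expect_emission_succ, PMF.expect_map]
    simp only [sampleStep, PMF.expect_pure]
  rw [hout, G.randomWalk_eq_map_walkTail, PMF.expect_map]
  have hsplit (t : Fin K → Fin r → Fin n → Fin n) :
      (G.walkTail L u).expect (fun b => f (Fin.cons u b)) ≤
        ((sampleDist T (IsLight t) s.toFinset).expect fun y =>
          ((algorithm n K r T).emission (secondState t s.toFinset y) u L (some (u, 0))).expect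
            fun b => f (Fin.cons u b)) +
        (G.walkTail L u).expect (fun b =>
          if WithinBudget (IsLight t) L (0 : Fin n → Fin (T + 1)) u b then 0 else 1) := by
    refine le_trans ?_ (add_le_add (expect_walkTail_le_expect_emission hs hK t u L u 0 _) le_rfl)
    rw [← PMF.expect_add]
    refine PMF.expect_mono _ fun b => ?_
    split_ifs
    · simp
    · simpa using hf _
  -- A bad table is charged its full probability; on a good one the exit bound applies with `P` the
  -- light pairs.
  have hbad (t : Fin K → Fin r → Fin n → Fin n) :
      (G.walkTail L u).expect (fun b =>
          if WithinBudget (IsLight t) L (0 : Fin n → Fin (T + 1)) u b then 0 else 1) ≤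
        (if ∀ a b, IsLight t a b → 1 / 4 ≤ G.avoidProb a r b then 0 else 1) +
          n * (2 ^ r * ((8 / 7) ^ T)⁻¹) := by
    split_ifs with ht
    · rw [zero_add]
      simpa using expect_not_withinBudget_le (IsLight t) G r T L hL ht u
    · refine le_trans ?_ le_self_add
      refine (PMF.expect_mono _ fun b => ?_).trans_eq (PMF.expect_const _ 1)
      split_ifs <;> simp
  rw [← PMF.expect_const (G.stepTable K r)
    ((G.walkTail L u).expect fun b => f (Fin.cons u b))]
  refine (PMF.expect_mono _ fun t => (hsplit t).trans (add_le_add le_rfl (hbad t))).trans ?_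
  rw [PMF.expect_add, PMF.expect_add, PMF.expect_const]
  refine add_le_add le_rfl (le_trans (add_le_add ?_ le_rfl) h)
  simpa using G.expect_exists_isLight_le K r

end TwoPassWalk

/-! ### Space -/

theorem fitsInWords_of_injective {n S : ℕ} {α β : Type} [Fintype β] (f : α → β)
    (hf : Function.Injective f) (h : Fintype.card β ≤ (2 ^ Nat.size n) ^ S) :
    FitsInWords n S α := by
  have hcard : Fintype.card β ≤ Fintype.card (Fin S → Fin (2 ^ Nat.size n)) := by simpa using h
  obtain ⟨g⟩ := Function.Embedding.nonempty_of_card_le hcard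
  refine ⟨⟨fun a i => BitVec.ofFin (g (f a) i), fun a b hab => hf (g.injective ?_)⟩⟩
  ext1 i
  exact BitVec.ofFin.inj (congrFun hab i)

namespace TwoPassWalk

variable {n : ℕ}

/-- The count is generous: every recorded bit is charged a word, and every budget counter `T` words
through `T + 1 ≤ 2 ^ T`. -/
theorem algorithm_usesSpace (hn : 1 ≤ n) (K r T : ℕ) :
    (algorithm n K r T).UsesSpace (1 + n * r * K + n + (r + 1) * K * n + n * T) := by
  have hW : n + 1 ≤ 2 ^ Nat.size n := Nat.lt_size_self n
  have h2 : 2 ≤ 2 ^ Nat.size n := by omega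
  have h1 : 1 ≤ 2 ^ Nat.size n := by omega
  have hn' : n ≤ 2 ^ Nat.size n := by omega
  have hmem : FitsInWords n (1 + n * r * K + n + (r + 1) * K * n + n * T) (Memory n K r T) := by
    refine fitsInWords_of_injective
      (fun m => (m.second, m.table, m.count, m.seen, m.samples)) ?_ ?_
    · rintro ⟨⟩ ⟨⟩ h
      simpa using h
    · simp only [Fintype.card_prod, Fintype.card_bool, Fintype.card_pi, Finset.prod_const,
        Finset.card_univ, Fintype.card_fin]
      calc 2 * (((n ^ n) ^ r) ^ K * ((n + 1) ^ n * (((2 ^ (r + 1)) ^ K) ^ n * n ^ (n * T))))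
          ≤ 2 ^ Nat.size n * ((((2 ^ Nat.size n) ^ n) ^ r) ^ K * ((2 ^ Nat.size n) ^ n *
            ((((2 ^ Nat.size n) ^ (r + 1)) ^ K) ^ n * (2 ^ Nat.size n) ^ (n * T)))) := by
            gcongr
        _ = (2 ^ Nat.size n) ^ (1 + n * r * K + n + (r + 1) * K * n + n * T) := by
            generalize 2 ^ Nat.size n = W
            simp only [← pow_mul, ← pow_add, ← pow_succ']
            congr 1; ring
  refine ⟨hmem, hmem, fitsInWords_of_injective id Function.injective_id ?_⟩
  simp only [Fintype.card_option, Fintype.card_prod, Fintype.card_pi, Finset.prod_const,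
    Finset.card_univ, Fintype.card_fin]
  calc n * (T + 1) ^ n + 1 ≤ (n + 1) * (T + 1) ^ n := by
        have : 1 ≤ (T + 1) ^ n := Nat.one_le_pow _ _ (by omega)
        linarith
    _ ≤ 2 ^ Nat.size n * ((2 ^ Nat.size n) ^ T) ^ n := by
        have : T + 1 ≤ (2 ^ Nat.size n) ^ T := Nat.lt_two_pow_self.trans_le (by gcongr)
        gcongr
    _ = (2 ^ Nat.size n) ^ (1 + n * T) := by
        rw [← pow_mul, pow_add, pow_one, mul_comm T n]
    _ ≤ _ := Nat.pow_le_pow_right h1 (by omega)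

/-! ### Choice of the parameters -/

/-- With `N ≥ log δ⁻¹`, `exp (-N) ≤ δ`. The choice `K = 4 * N` gives `n² δ⁴`; in `T`, the part `8 *
r` absorbs `2 ^ r` and the part `24 * N` gives `n δ³`. Each is at most `δ / 2` since `n δ ≤ 1` and
`δ ≤ 1 / 2`. -/
theorem error_le {δ : ℝ} (hδ : 0 < δ) (hn : 2 ≤ n) (hδn : δ < 1 / (n : ℝ)) (r N : ℕ)
    (hN : Real.log δ⁻¹ ≤ N) :
    (n : ℝ≥0∞) * n * (1 / 4) ^ (4 * N) + n * (2 ^ r * ((8 / 7) ^ (8 * (r + 3 * N)))⁻¹) ≤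
      ENNReal.ofReal δ := by
  have hn0 : (0 : ℝ) < n := by positivity
  have hn2 : (2 : ℝ) ≤ n := by exact_mod_cast hn
  have hnδ : n * δ ≤ 1 := by
    rw [lt_div_iff₀ hn0] at hδn; linarith
  have hδ2 : δ ≤ 1 / 2 := by nlinarith
  set z : ℝ := Real.exp (-1) with hz
  have hz0 : 0 < z := Real.exp_pos _
  have hzN : z ^ N ≤ δ := by
    rw [hz, ← Real.exp_nat_mul, ← Real.exp_log hδ, Real.exp_le_exp]
    rw [Real.log_inv] at hN
    linarith
  have hez : z * Real.exp 1 = 1 := by rw [hz, ← Real.exp_add]; simp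
  have he := Real.exp_one_lt_d9
  have he2 := Real.exp_one_gt_d9
  have h4 : 1 / 4 ≤ z := by nlinarith
  have hz2 : 2 * z ≤ 1 := by nlinarith
  -- Eight samples per unit suffice because `(8/7) ^ 8 > e`.
  have h87 : ((8 / 7 : ℝ) ^ 8)⁻¹ ≤ z := by
    rw [hz, Real.exp_neg]
    exact inv_anti₀ (Real.exp_pos 1) (he.le.trans (by norm_num))
  have hA : (n : ℝ) * n * (1 / 4) ^ (4 * N) ≤ δ / 2 := by
    have : (1 / 4 : ℝ) ^ (4 * N) ≤ δ ^ 4 := by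
      calc (1 / 4 : ℝ) ^ (4 * N) ≤ z ^ (4 * N) := by gcongr
        _ = (z ^ N) ^ 4 := by rw [mul_comm, pow_mul]
        _ ≤ δ ^ 4 := by gcongr
    calc (n : ℝ) * n * (1 / 4) ^ (4 * N) ≤ n * n * δ ^ 4 := by gcongr
      _ = (n * δ) * (n * δ) * (δ * δ) := by ring
      _ ≤ 1 * 1 * (δ * (1 / 2)) := by gcongr
      _ = δ / 2 := by ring
  have hB : (n : ℝ) * (2 ^ r * ((8 / 7) ^ (8 * (r + 3 * N)))⁻¹) ≤ δ / 2 := by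
    have : (2 : ℝ) ^ r * ((8 / 7) ^ (8 * (r + 3 * N)))⁻¹ ≤ δ ^ 3 := by
      calc (2 : ℝ) ^ r * ((8 / 7) ^ (8 * (r + 3 * N)))⁻¹
          = 2 ^ r * (((8 / 7) ^ 8)⁻¹) ^ (r + 3 * N) := by rw [pow_mul, inv_pow]
        _ ≤ 2 ^ r * z ^ (r + 3 * N) := by gcongr
        _ = (2 * z) ^ r * (z ^ N) ^ 3 := by rw [pow_add, mul_pow, mul_comm 3 N, pow_mul]; ring
        _ ≤ 1 * δ ^ 3 := by
            gcongr
            exact pow_le_one₀ (by positivity) hz2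
        _ = δ ^ 3 := one_mul _
    calc (n : ℝ) * (2 ^ r * ((8 / 7) ^ (8 * (r + 3 * N)))⁻¹) ≤ n * δ ^ 3 := by gcongr
      _ = (n * δ) * (δ * δ) := by ring
      _ ≤ 1 * (δ * (1 / 2)) := by gcongr
      _ = δ / 2 := by ring
  have e4 : (1 / 4 : ℝ≥0∞) = ENNReal.ofReal (1 / 4) := by
    rw [ENNReal.ofReal_div_of_pos (by norm_num)]; simp
  have e8 : (8 / 7 : ℝ≥0∞) = ENNReal.ofReal (8 / 7) := by
    rw [ENNReal.ofReal_div_of_pos (by norm_num)]; simp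
  have e2 : (2 : ℝ≥0∞) = ENNReal.ofReal 2 := by simp
  rw [e4, e8, e2, ← ENNReal.ofReal_natCast, ← ENNReal.ofReal_pow (by norm_num),
    ← ENNReal.ofReal_pow (by norm_num), ← ENNReal.ofReal_pow (by norm_num),
    ← ENNReal.ofReal_inv_of_pos (by positivity), ← ENNReal.ofReal_mul (by positivity),
    ← ENNReal.ofReal_mul (by positivity), ← ENNReal.ofReal_mul (by positivity),
    ← ENNReal.ofReal_mul (by positivity), ← ENNReal.ofReal_add (by positivity) (by positivity)]
  exact ENNReal.ofReal_le_ofReal (by linarith)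

/-- Without memory, output the starting vertex forever. -/
noncomputable def constantAlgorithm (n : ℕ) : ObliviousStreamingAlgorithm n 2 where
  Mem := Unit
  Msg := Unit
  Work := Unit
  init := ()
  update _ _ := PMF.pure ()
  endPass _ := PMF.pure ()
  message _ := ()
  start := ()
  next _ u _ := PMF.pure (u, ())

theorem constantAlgorithm_usesSpace (n : ℕ) : (constantAlgorithm n).UsesSpace 0 := by
  have h : FitsInWords n 0 Unit := fitsInWords_of_injective id Function.injective_id (by simp)
  exact ⟨h, h, h⟩

theorem constantAlgorithm_output_zero (G : Digraph (Fin n)) (s : List (Fin n × Fin n))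
    (u : Fin n) : (constantAlgorithm n).output s u 0 = G.randomWalk 0 u := by
  simp [ObliviousStreamingAlgorithm.output, ObliviousStreamingAlgorithm.emit, constantAlgorithm,
    Digraph.randomWalk, PMF.pure_map]

theorem _root_.PMF.tvDist_self {α : Type*} [Fintype α] (p : PMF α) : PMF.tvDist p p = 0 := by
  simp [PMF.tvDist]

theorem _root_.PMF.eq_of_subsingleton {α : Type*} [Subsingleton α] (p q : PMF α) : p = q := by
  refine PMF.ext_expect fun f => ?_
  obtain ⟨a, -⟩ := p.support_nonempty
  have hf : f = fun _ => f a := funext fun b => congrArg f (Subsingleton.elim b a)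
  rw [hf, PMF.expect_const, PMF.expect_const]

/-- The algorithm for walks of length `L` with error `δ`. -/
noncomputable def walkSimulator (n L : ℕ) (δ : ℝ) : ObliviousStreamingAlgorithm n 2 :=
  -- The space bound is 0 when `L = 0`, and can be arbitrarily small when `n = 1`, where `δ` may be
  -- close to 1. The output is then deterministic and needs no memory.
  if n ≤ 1 ∨ L = 0 then constantAlgorithm n
  else algorithm n (4 * ⌈Real.log δ⁻¹⌉₊) (L.sqrt + 1) (8 * (L.sqrt + 1 + 3 * ⌈Real.log δ⁻¹⌉₊))

theorem space_le {L : ℕ} {ℓ : ℝ} (hn : 1 ≤ n) (hL : 1 ≤ L) (hℓ : 1 / 2 ≤ ℓ) :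
    ((1 + n * (L.sqrt + 1) * (4 * ⌈ℓ⌉₊) + n + (L.sqrt + 1 + 1) * (4 * ⌈ℓ⌉₊) * n +
      n * (8 * (L.sqrt + 1 + 3 * ⌈ℓ⌉₊)) : ℕ) : ℝ) ≤ 276 * ((n : ℝ) * √(L : ℝ) * ℓ) := by
  have hN : (⌈ℓ⌉₊ : ℝ) ≤ 3 * ℓ := by
    have := Nat.ceil_lt_add_one (show 0 ≤ ℓ by linarith)
    linarith
  have hN1 : (1 : ℝ) ≤ ⌈ℓ⌉₊ := by
    exact_mod_cast Nat.one_le_ceil_iff.mpr (by linarith)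
  have hL1 : (1 : ℝ) ≤ √(L : ℝ) := Real.one_le_sqrt.mpr (by exact_mod_cast hL)
  have hr : ((L.sqrt + 1 : ℕ) : ℝ) ≤ 2 * √(L : ℝ) := by
    have := Real.nat_sqrt_le_real_sqrt (a := L)
    push_cast; linarith
  have hr1 : (1 : ℝ) ≤ ((L.sqrt + 1 : ℕ) : ℝ) := by simp
  have hn1 : (1 : ℝ) ≤ n := by exact_mod_cast hn
  generalize L.sqrt + 1 = r at *
  generalize ⌈ℓ⌉₊ = N at *
  have h0 : (n : ℝ) * r ≤ n * r * N := le_mul_of_one_le_right (by positivity) hN1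
  have h1 : (n : ℝ) ≤ n * r := le_mul_of_one_le_right (by positivity) hr1
  have h2 : (n : ℝ) * N ≤ n * r * N := by gcongr
  push_cast
  -- In units of `n * r * N` the terms cost `1 + 4 + 1 + 8 + 32 = 46`; the bounds `r ≤ 2√L` and `N ≤
  -- 3ℓ` contribute the factor 6 in 276.
  calc (1 : ℝ) + n * r * (4 * N) + n + (r + 1) * (4 * N) * n + n * (8 * (r + 3 * N))
      ≤ 46 * (n * r * N) := by linarith
    _ ≤ 46 * (n * (2 * √(L : ℝ)) * (3 * ℓ)) := by gcongr
    _ = 276 * ((n : ℝ) * √(L : ℝ) * ℓ) := by ring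

end TwoPassWalk

/-! ### The main theorem -/

open TwoPassWalk in
theorem theorem1 :
    ∃ (C : ℝ) (A : (n L : ℕ) → (δ : ℝ) → ObliviousStreamingAlgorithm n 2),
      ∀ (n L : ℕ) (δ : ℝ), 0 < δ → δ < 1 / (n : ℝ) →
        (∃ S : ℕ, (S : ℝ) ≤ C * ((n : ℝ) * Real.sqrt (L : ℝ) * Real.log δ⁻¹) ∧
          (A n L δ).UsesSpace S) ∧
        ∀ (G : Digraph (Fin n)) (s : List (Fin n × Fin n)), G.IsEdgeStream s →
          ∀ u : Fin n,
            PMF.tvDist ((A n L δ).output s u L) (G.randomWalk L u) ≤ δ := by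
  refine ⟨276, walkSimulator, fun n L δ hδ hδn => ?_⟩
  have hn : 1 ≤ n := by
    rcases Nat.eq_zero_or_pos n with rfl | h
    · simp at hδn; linarith
    · exact h
  have hn1 : (1 : ℝ) ≤ n := by exact_mod_cast hn
  have hδ1 : δ < 1 := hδn.trans_le (div_le_one_of_le₀ hn1 (by positivity))
  have hlog : 0 ≤ Real.log δ⁻¹ := Real.log_nonneg ((one_le_inv₀ hδ).mpr hδ1.le)
  unfold walkSimulator
  split_ifs with h
  · refine ⟨⟨0, by simp only [Nat.cast_zero]; positivity, constantAlgorithm_usesSpace n⟩,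
      fun G s _ u => ?_⟩
    suffices heq : (constantAlgorithm n).output s u L = G.randomWalk L u by
      rw [heq, PMF.tvDist_self]; exact hδ.le
    rcases h with h | rfl
    · obtain rfl : n = 1 := by omega
      exact PMF.eq_of_subsingleton _ _
    · exact constantAlgorithm_output_zero G s u
  · push Not at h
    have hhalf : δ < 1 / 2 := hδn.trans_le (by
      have : (2 : ℝ) ≤ n := by exact_mod_cast h.1
      gcongr)
    have hℓ : 1 / 2 ≤ Real.log δ⁻¹ := by
      have h2 : Real.log 2 ≤ Real.log δ⁻¹ := by
        refine Real.log_le_log (by norm_num) ?_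
        rw [le_inv_comm₀ (by norm_num) hδ]
        linarith
      linarith [Real.log_two_gt_d9]
    refine ⟨⟨_, space_le hn (Nat.one_le_iff_ne_zero.mpr h.2) hℓ, algorithm_usesSpace hn _ _ _⟩,
      fun G s hs u => ?_⟩
    refine tvDist_output_le hs ?_ L (Nat.lt_succ_sqrt L).le u hδ.le
      (error_le hδ h.1 hδn _ _ (Nat.le_ceil _))
    have : 0 < ⌈Real.log δ⁻¹⌉₊ := Nat.ceil_pos.mpr (by linarith)
    omega
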